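/- Let $1\le p\le n$ and let $G,F_1,\ldots,F_p\in\mathbb{R}[X_1,\ldots,X_n]$. For a subset $S\subseteq\mathbb{C}^n$ write $S_{\mathbb{R}}:=S\cap\mathbb{R}^n$. Topological notions (irreducible components, dimension) refer to the Zariski topology of $\mathbb{C}^n$. A point $x\in\mathbb{C}^n$ is called $(H_1,\ldots,H_m)$-regular, for $H_1,\ldots,H_m\in\mathbb{R}[X_1,\ldots,X_n]$, if the Jacobian $J(H_1,\ldots,H_m)$ has rank $m$ at $x$. Let $V:=\{x\in\mathbb{C}^n : F_1(x)=\cdots=F_p(x)=0\}$ and suppose that $V_{\mathbb{R}}$ is non-empty and that each of its points is $(F_1,\ldots,F_p)$-regular. Let $A:=\begin{bmatrix}J(F_1,\ldots,F_p)\\ \nabla G\end{bmatrix}$, a $(p+1)\times n$ matrix of polynomials, and $$W:=\{x\in V : \operatorname{rank} A(x)\le p\}.$$ For $1\le k\le n-p$ let $D_k$ be the union of all irreducible components of $W$ of dimension strictly larger than $n-p-k$. For $\mathcal{J}=(j_1<\cdots<j_p)$ with $1\le j_1$ and $j_p\le n$, let $\Delta_{\mathcal{J}}$ be the $p$-minor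 of $J(F_1,\ldots,F_p)$ given by the columns in $\mathcal{J}$, and let $M_1^{\mathcal{J}},\ldots,M_{n-p}^{\mathcal{J}}$ be the $(p+1)$-minors of $A$ given by the columns in $\mathcal{J}$ together with one further column, the further column running in increasing order through $\{1,\ldots,n\}\setminus\mathcal{J}$. Put $$S_{\mathcal{J},k}:=\{x\in V : \Delta_{\mathcal{J}}(x)\ne 0,\ M_1^{\mathcal{J}}(x)=\cdots=M_k^{\mathcal{J}}(x)=0\}\setminus D_k .$$ Assume Condition B: (i) for all $\mathcal{J}$ and all $1\le k\le n-p$, every point of $(S_{\mathcal{J},k})_{\mathbb{R}}$ is $(F_1,\ldots,F_p,M_1^{\mathcal{J}},\ldots,M_k^{\mathcal{J}})$-regular; (ii) for all $\mathcal{J}$ and all $1\le k\le n-p$, every irreducible component of $S_{\mathcal{J},k}$ contains a point of $\mathbb{R}^n$; (iii) every irreducible component of $W$ has dimension strictly smaller than $n-p$ and contains a point of $\mathbb{R}^n$. Then for every irreducible component $C$ of $W$ there is a real number $b$ such that $G(x)=b$ for all $x\in C$. -/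

import Mathlib

namespace PolyOpt

open MvPolynomial

/-! ### The Zariski topology on complex affine space -/

/-- The common zeros in `ℂⁿ` of a set of complex polynomials. -/
def zeros {n : ℕ} (P : Set (MvPolynomial (Fin n) ℂ)) : Set (Fin n → ℂ) :=
  {x | ∀ f ∈ P, eval x f = 0}

/-- The Zariski topology on `ℂⁿ`: the closed sets are exactly the zero sets of sets of complex
polynomials. It is not an instance, since `Fin n → ℂ` carries the Euclidean topology. -/
@[reducible] def zariski (n : ℕ) : TopologicalSpace (Fin n → ℂ) :=
  TopologicalSpace.ofClosed {S | ∃ P : Set (MvPolynomial (Fin n) ℂ), S = zeros P}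
    ⟨{1}, by ext x; simp [zeros]⟩
    (by
      intro A hA
      have hA' : ∀ S, ∃ P : Set (MvPolynomial (Fin n) ℂ), S ∈ A → S = zeros P := by
        intro S
        by_cases hS : S ∈ A
        · obtain ⟨P, hP⟩ := hA hS
          exact ⟨P, fun _ => hP⟩
        · exact ⟨∅, fun h => absurd h hS⟩
      choose P hP using hA'
      refine ⟨⋃ S ∈ A, P S, ?_⟩
      ext x
      simp only [Set.mem_sInter, zeros, Set.mem_iUnion, Set.mem_ofPred_eq]
      constructor
      · rintro h f ⟨S, hS, hf⟩
        have := h S hS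
        rw [hP S hS] at this
        exact this f hf
      · intro h S hS
        rw [hP S hS]
        exact fun f hf => h f ⟨S, hS, hf⟩)
    (by
      rintro _ ⟨P, rfl⟩ _ ⟨Q, rfl⟩
      refine ⟨{h | ∃ f ∈ P, ∃ g ∈ Q, h = f * g}, ?_⟩
      ext x
      simp only [Set.mem_union, zeros, Set.mem_ofPred_eq]
      constructor
      · rintro (h | h) _ ⟨f, hf, g, hg, rfl⟩
        · simp [h f hf]
        · simp [h g hg]
      · intro h
        by_contra! hc
        obtain ⟨⟨f, hf, hfx⟩, g, hg, hgx⟩ := hc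
        have := h _ ⟨f, hf, g, hg, rfl⟩
        rw [eval_mul] at this
        exact (mul_ne_zero hfx hgx) this)

/-- `C` is an irreducible component of the subset `S` of `ℂⁿ` (with the topology induced by the
Zariski topology): a maximal irreducible subset of `S`. -/
def IsIrredComponent {n : ℕ} (S C : Set (Fin n → ℂ)) : Prop :=
  Maximal (fun T => T ⊆ S ∧ @IsIrreducible _ (zariski n) T) C

/-- The dimension of a subset of `ℂⁿ`: its Krull dimension as a topological space with the
topology induced by the Zariski topology. -/
noncomputable def dim {n : ℕ} (S : Set (Fin n → ℂ)) : WithBot ℕ∞ :=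
  @topologicalKrullDim S (TopologicalSpace.induced Subtype.val (zariski n))

/-- The real trace `S ∩ ℝⁿ` of a subset `S` of `ℂⁿ`. -/
def realTrace {n : ℕ} (S : Set (Fin n → ℂ)) : Set (Fin n → ℂ) :=
  {x ∈ S | ∀ i, (x i).im = 0}

/-! ### Jacobians, varieties and minors -/

/-- The complex variety of all common zeros in `ℂⁿ` of a family of real polynomials. -/
def variety {n : ℕ} {ι : Type*} (F : ι → MvPolynomial (Fin n) ℝ) : Set (Fin n → ℂ) :=
  {x | ∀ i, aeval x (F i) = 0}

/-- The Jacobian matrix `[∂F_i/∂X_j]`. -/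
noncomputable def jacobian {n : ℕ} {ι : Type*} (F : ι → MvPolynomial (Fin n) ℝ) :
    Matrix ι (Fin n) (MvPolynomial (Fin n) ℝ) :=
  Matrix.of fun i j => pderiv j (F i)

/-- The value of a matrix of real polynomials at a point of `ℂⁿ`. -/
noncomputable def valueAt {n : ℕ} {ι κ : Type*} (A : Matrix ι κ (MvPolynomial (Fin n) ℝ))
    (x : Fin n → ℂ) : Matrix ι κ ℂ :=
  A.map (aeval x)

/-- `x` is an `F`-regular point: the Jacobian of the family `F` has full row rank at `x`. -/
def IsRegularAt {n : ℕ} {ι : Type*} [Fintype ι] (F : ι → MvPolynomial (Fin n) ℝ)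
    (x : Fin n → ℂ) : Prop :=
  (valueAt (jacobian F) x).rank = Fintype.card ι

/-- The `(p+1) × n` matrix whose first `p` rows form `J(F₁, …, F_p)` and whose last row is the
gradient of `G`. -/
noncomputable def augmented {n p : ℕ} (F : Fin p → MvPolynomial (Fin n) ℝ)
    (G : MvPolynomial (Fin n) ℝ) : Matrix (Fin (p + 1)) (Fin n) (MvPolynomial (Fin n) ℝ) :=
  jacobian (Fin.snoc (α := fun _ => MvPolynomial (Fin n) ℝ) F G)

/-- The variety `W` of the points of `V = {F₁ = 0, …, F_p = 0}` at which the augmented matrix has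
rank at most `p`. -/
def critical {n p : ℕ} (F : Fin p → MvPolynomial (Fin n) ℝ) (G : MvPolynomial (Fin n) ℝ) :
    Set (Fin n → ℂ) :=
  {x ∈ variety F | (valueAt (augmented F G) x).rank ≤ p}

/-- The minor `Δ_J` of `J(F₁, …, F_p)` given by the columns `J₁ < ⋯ < J_p`. -/
noncomputable def minorDelta {n p : ℕ} (F : Fin p → MvPolynomial (Fin n) ℝ)
    (J : Fin p ↪o Fin n) : MvPolynomial (Fin n) ℝ :=
  ((jacobian F).submatrix id J).det

/-- The increasing enumeration of the `n - p` column indices that do not belong to `J`. -/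
noncomputable def otherColumn {n p : ℕ} (J : Fin p ↪o Fin n) : Fin (n - p) ↪o Fin n :=
  (Finset.univ.map J.toEmbedding)ᶜ.orderEmbOfFin (by
    rw [Finset.card_compl, Finset.card_map, Finset.card_univ, Fintype.card_fin, Fintype.card_fin])

/-- The `(p+1)`-minor `M_{i+1}^J` of the augmented matrix, given by the columns in `J` and the
`i`-th of the other columns (`i` counted from `0`). The added column is written last; this
affects at most the sign. -/
noncomputable def minorM {n p : ℕ} (F : Fin p → MvPolynomial (Fin n) ℝ)
    (G : MvPolynomial (Fin n) ℝ) (J : Fin p ↪o Fin n) (i : Fin (n - p)) :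
    MvPolynomial (Fin n) ℝ :=
  ((augmented F G).submatrix id
    (Fin.snoc (α := fun _ => Fin n) J (otherColumn J i))).det

/-- The system `F₁, …, F_p, M₁^J, …, M_k^J`. -/
noncomputable def systemFM {n p : ℕ} (F : Fin p → MvPolynomial (Fin n) ℝ)
    (G : MvPolynomial (Fin n) ℝ) (J : Fin p ↪o Fin n) (k : ℕ) (hk : k ≤ n - p) :
    Fin p ⊕ Fin k → MvPolynomial (Fin n) ℝ :=
  Sum.elim F fun i => minorM F G J (Fin.castLE hk i)

/-- `D_k`: the union of all irreducible components of `W` of dimension strictly larger than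
`n - p - k`. -/
def bigPart {n p : ℕ} (F : Fin p → MvPolynomial (Fin n) ℝ) (G : MvPolynomial (Fin n) ℝ)
    (k : ℕ) : Set (Fin n → ℂ) :=
  ⋃₀ {C | IsIrredComponent (critical F G) C ∧
    (n : WithBot ℕ∞) < dim C + ((p + k : ℕ) : WithBot ℕ∞)}

/-- The locally closed set `(V_{Δ_J} ∩ {M₁^J = 0, …, M_k^J = 0}) \ D_k`. -/
def stratum {n p : ℕ} (F : Fin p → MvPolynomial (Fin n) ℝ) (G : MvPolynomial (Fin n) ℝ)
    (J : Fin p ↪o Fin n) (k : ℕ) (hk : k ≤ n - p) : Set (Fin n → ℂ) :=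
  {x ∈ variety (systemFM F G J k hk) | aeval x (minorDelta F J) ≠ 0} \ bigPart F G k

/-- Condition B on the polynomials `G, F₁, …, F_p`. -/
structure ConditionB {n p : ℕ} (F : Fin p → MvPolynomial (Fin n) ℝ)
    (G : MvPolynomial (Fin n) ℝ) : Prop where
  /-- For each index sequence `J` and `1 ≤ k ≤ n - p`, the real points of
  `(V_{Δ_J} ∩ {M₁^J = 0, …, M_k^J = 0}) \ D_k` are `(F₁, …, F_p, M₁^J, …, M_k^J)`-regular. -/
  regular : ∀ (J : Fin p ↪o Fin n) (k : ℕ) (hk : k ≤ n - p), 1 ≤ k →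
    ∀ x ∈ realTrace (stratum F G J k hk), IsRegularAt (systemFM F G J k hk) x
  /-- Each irreducible component of these sets contains a real point. -/
  real_stratum : ∀ (J : Fin p ↪o Fin n) (k : ℕ) (hk : k ≤ n - p), 1 ≤ k →
    ∀ C, IsIrredComponent (stratum F G J k hk) C → (realTrace C).Nonempty
  /-- Each irreducible component of `W` has dimension strictly smaller than `n - p`. -/
  dim_lt : ∀ C, IsIrredComponent (critical F G) C → dim C + (p : WithBot ℕ∞) < (n : WithBot ℕ∞)
  /-- Each irreducible component of `W` contains a real point. -/
  real_critical : ∀ C, IsIrredComponent (critical F G) C → (realTrace C).Nonempty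

end PolyOpt

/-! Let `K` be the function field of `C`. At a real point of `C` the gradients of the `F i` are
independent, hence also over `K`, while the rank bound holds on all of `C` and so over `K`
(`rank_residueField_eq_card_iff`). Thus `∇G` is a `K`-combination of the `∇F i`. In `Ω[K⁄ℂ]` every
`dF i` vanishes, so `dG = 0`. In characteristic zero this makes `G` algebraic over `ℂ`, hence a
constant, and its value at the real point is real. -/

open TensorProduct in
/-- In characteristic zero, the differential of a transcendental element of a finitely generated
field extension does not vanish. -/
theorem Transcendental.kaehlerDifferential_D_ne_zero {k K : Type*} [Field k] [CharZero k] [Field K]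
    [Algebra k K] [Algebra.EssFiniteType k K] {g : K} (hg : Transcendental k g) :
    KaehlerDifferential.D k K g ≠ 0 := by
  let _ : Algebra (Polynomial k) K := (Polynomial.aeval (R := k) g).toAlgebra
  have hX : algebraMap (Polynomial k) K Polynomial.X = g := Polynomial.aeval_X g
  have : IsScalarTower k (Polynomial k) K :=
    .of_algebraMap_eq' (Polynomial.aeval (R := k) g).comp_algebraMap.symm
  have : FaithfulSMul (Polynomial k) K :=
    (faithfulSMul_iff_algebraMap_injective _ _).2 (transcendental_iff_injective.1 hg)
  let _ := FractionRing.liftAlgebra (Polynomial k) K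
  have := FractionRing.isScalarTower_liftAlgebra (Polynomial k) K
  have : IsScalarTower k (FractionRing (Polynomial k)) K := .to₁₃₄ k (Polynomial k) _ _
  have : Algebra.EssFiniteType (FractionRing (Polynomial k)) K := .of_comp k _ _
  have : Algebra.FormallySmooth (Polynomial k) (FractionRing (Polynomial k)) :=
    .of_isLocalization (nonZeroDivisors _)
  -- Characteristic zero enters here: it makes `K` formally smooth over `k(X)`, where `X` maps to
  -- `g`.
  have : Algebra.FormallySmooth (Polynomial k) K := .comp _ (FractionRing (Polynomial k)) _
  have hinj : Function.Injective (KaehlerDifferential.mapBaseChange k (Polynomial k) K) := by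
    rw [injective_iff_map_eq_zero]
    intro x hx
    obtain ⟨y, rfl⟩ := (Algebra.H1Cotangent.exact_δ_mapBaseChange k (Polynomial k) K x).1 hx
    -- Formal smoothness kills `H1Cotangent`, the source of the connecting map `δ`.
    rw [Subsingleton.elim y 0, map_zero]
  intro h
  have h1 : (1 : K) ⊗ₜ[Polynomial k] KaehlerDifferential.D k (Polynomial k) Polynomial.X = 0 := by
    apply hinj
    simp [hX, h]
  -- `dX` is a basis of the differentials of `k[X]`, so `1 ⊗ dX` corresponds to `1` in `K`.
  have h2 := congrArg (LinearMap.lTensor K (KaehlerDifferential.polynomialEquiv k).toLinearMap) h1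
  have h3 := congrArg (TensorProduct.rid (Polynomial k) K) h2
  simp at h3

/-- The chain rule, which turns linear relations between gradients into relations between
differentials. -/
theorem KaehlerDifferential.D_algebraMap_mvPolynomial {k K σ : Type*} [CommRing k] [CommRing K]
    [Fintype σ] [Algebra k K] [Algebra (MvPolynomial σ k) K] [IsScalarTower k (MvPolynomial σ k) K]
    (P : MvPolynomial σ k) :
    KaehlerDifferential.D k K (algebraMap _ K P) =
      ∑ j, algebraMap _ K (MvPolynomial.pderiv j P) •
        KaehlerDifferential.D k K (algebraMap (MvPolynomial σ k) K (MvPolynomial.X j)) := by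
  classical
  induction P using MvPolynomial.induction_on with
  | C a =>
    have h : algebraMap (MvPolynomial σ k) K (MvPolynomial.C a) = algebraMap k K a :=
      (IsScalarTower.algebraMap_apply k (MvPolynomial σ k) K a).symm
    simp [h]
  | add P Q hP hQ => simp [hP, hQ, add_smul, Finset.sum_add_distrib]
  | mul_X P i hP =>
    simp [hP, add_smul, Finset.sum_add_distrib, MvPolynomial.pderiv_X, Pi.single_apply,
      Finset.smul_sum, mul_smul, apply_ite, ite_smul]

namespace Matrix

variable {m n R K : Type*} [Fintype m] [Fintype n] [DecidableEq m] [CommRing R] [Field K]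

/-- The element `(A * B).det` of `R` is a certificate of full row rank that can be tested under
different homomorphisms out of `R`. -/
theorem rank_map_eq_card_of_det_mul_ne_zero (f : R →+* K) (A : Matrix m n R) (B : Matrix n m R)
    (h : f (A * B).det ≠ 0) : (A.map f).rank = Fintype.card m := by
  refine le_antisymm (rank_le_card_height _) ?_
  rw [RingHom.map_det, RingHom.mapMatrix_apply, Matrix.map_mul] at h
  rw [← rank_of_det_ne_zero h]
  exact rank_mul_le_left _ _

theorem exists_mul_eq_one_of_rank_eq_card (A : Matrix m n K) (h : A.rank = Fintype.card m) :
    ∃ B : Matrix n m K, A * B = 1 := by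
  rw [← mulVec_surjective_iff_exists_right_inverse]
  have : LinearMap.range A.mulVecLin = ⊤ :=
    Submodule.eq_top_of_finrank_eq (by simpa [rank] using h)
  exact LinearMap.range_eq_top.1 this

/-- If every element of `K` is, up to a common denominator, in the image of `f`, then full row rank
of `A` over `K` is witnessed by a determinant over `R`. -/
theorem exists_det_mul_ne_zero (f : R →+* K) (A : Matrix m n R)
    (hf : ∀ B : Matrix n m K, ∃ c : K, c ≠ 0 ∧ ∃ B' : Matrix n m R, B'.map f = c • B)
    (h : (A.map f).rank = Fintype.card m) : ∃ B : Matrix n m R, f (A * B).det ≠ 0 := by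
  obtain ⟨B, hB⟩ := exists_mul_eq_one_of_rank_eq_card _ h
  obtain ⟨c, hc, B', hB'⟩ := hf B
  refine ⟨B', ?_⟩
  rw [RingHom.map_det, RingHom.mapMatrix_apply, Matrix.map_mul, hB', Matrix.mul_smul, hB, det_smul,
    det_one, mul_one]
  exact pow_ne_zero _ hc

end Matrix

namespace PolyOpt

open MvPolynomial

theorem mem_zeros_singleton {n : ℕ} {f : MvPolynomial (Fin n) ℂ} {x : Fin n → ℂ} :
    x ∈ zeros {f} ↔ eval x f = 0 :=
  ⟨fun h => h f rfl, fun h _ hg => hg ▸ h⟩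

theorem isClosed_zeros {n : ℕ} (P : Set (MvPolynomial (Fin n) ℂ)) :
    @IsClosed _ (zariski n) (zeros P) := by
  refine @IsClosed.mk _ (zariski n) _ ?_
  exact ⟨P, compl_compl _⟩

theorem isPrime_vanishingIdeal {n : ℕ} {C : Set (Fin n → ℂ)} (hC : @IsIrreducible _ (zariski n) C) :
    (vanishingIdeal ℂ C).IsPrime := by
  refine ⟨fun h => ?_, fun {f g} hfg => ?_⟩
  · obtain ⟨x, hx⟩ := hC.1
    have : (1 : MvPolynomial (Fin n) ℂ) ∈ vanishingIdeal ℂ C := h ▸ Submodule.mem_top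
    simpa using mem_vanishingIdeal_iff.1 this x hx
  · have h := (@isPreirreducible_iff_isClosed_union_isClosed _ (zariski n) C).1 hC.2 _ _
      (isClosed_zeros {f}) (isClosed_zeros {g}) (fun x hx => by
        have := mem_vanishingIdeal_iff.1 hfg x hx
        rw [aeval_eq_eval] at this
        simpa only [Set.mem_union, mem_zeros_singleton, coe_eval₂Hom, eval_mul, mul_eq_zero]
          using this)
    refine h.imp (fun h => ?_) (fun h => ?_) <;>
    · rw [mem_vanishingIdeal_iff]
      intro x hx
      rw [aeval_eq_eval]
      exact mem_zeros_singleton.1 (h hx)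

theorem essFiniteType_residueField {n : ℕ} (I : Ideal (MvPolynomial (Fin n) ℂ)) [I.IsPrime] :
    Algebra.EssFiniteType ℂ I.ResidueField :=
  have : Algebra.EssFiniteType (MvPolynomial (Fin n) ℂ ⧸ I) I.ResidueField :=
    .of_isLocalization _ (nonZeroDivisors _)
  .comp _ (MvPolynomial (Fin n) ℂ ⧸ I) _

theorem exists_map_eq_smul {R l m : Type*} [CommRing R] [Finite l] [Finite m] (I : Ideal R)
    [I.IsPrime] (B : Matrix l m I.ResidueField) :
    ∃ c : I.ResidueField, c ≠ 0 ∧ ∃ B' : Matrix l m R,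
      B'.map (algebraMap R I.ResidueField) = c • B := by
  obtain ⟨b, hb⟩ := IsLocalization.exist_integer_multiples_of_finite
    (nonZeroDivisors (R ⧸ I)) (fun ij : l × m => B ij.1 ij.2)
  refine ⟨algebraMap (R ⧸ I) _ b, ?_, ?_⟩
  · simp
  · choose s hs using hb
    choose t ht using fun ij => Ideal.Quotient.mk_surjective (I := I) (s ij)
    refine ⟨Matrix.of fun i j => t (i, j), ?_⟩
    ext i j
    have h := hs (i, j)
    rw [← ht, Algebra.smul_def] at h
    simpa using h

/-- A certificate `(A * B).det` is nonzero in the residue field exactly when it lies outside the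
vanishing ideal, that is, when it is nonzero at some point of `C`. -/
theorem rank_residueField_eq_card_iff {n r : ℕ} {m : Type*} [Fintype m] [DecidableEq m]
    {C : Set (Fin n → ℂ)} [(vanishingIdeal ℂ C).IsPrime]
    (A : Matrix m (Fin r) (MvPolynomial (Fin n) ℂ)) :
    (A.map (algebraMap _ (vanishingIdeal ℂ C).ResidueField)).rank = Fintype.card m ↔
      ∃ x ∈ C, (A.map (eval x)).rank = Fintype.card m := by
  constructor
  · intro h
    obtain ⟨B, hB⟩ := Matrix.exists_det_mul_ne_zero _ A (exists_map_eq_smul _) h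
    rw [Ne, Ideal.algebraMap_residueField_eq_zero, mem_vanishingIdeal_iff] at hB
    push Not at hB
    obtain ⟨x, hx, hBx⟩ := hB
    exact ⟨x, hx, Matrix.rank_map_eq_card_of_det_mul_ne_zero _ A B (by rwa [aeval_eq_eval] at hBx)⟩
  · rintro ⟨x, hx, h⟩
    obtain ⟨B, hB⟩ := Matrix.exists_det_mul_ne_zero (eval x) A
      (fun B => ⟨1, one_ne_zero, B.map MvPolynomial.C, by ext; simp⟩) h
    refine Matrix.rank_map_eq_card_of_det_mul_ne_zero _ A B fun h0 => hB ?_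
    rw [Ideal.algebraMap_residueField_eq_zero, mem_vanishingIdeal_iff] at h0
    simpa [aeval_eq_eval] using h0 x hx

theorem aeval_eq_eval_map {σ : Type*} (x : σ → ℂ) (P : MvPolynomial σ ℝ) :
    aeval x P = eval x (MvPolynomial.map (algebraMap ℝ ℂ) P) := by
  rw [aeval_def, eval₂_eq_eval_map]

theorem valueAt_jacobian {n : ℕ} {ι : Type*} (F : ι → MvPolynomial (Fin n) ℝ) (x : Fin n → ℂ) :
    valueAt (jacobian F) x =
      ((jacobian F).map (MvPolynomial.map (algebraMap ℝ ℂ))).map (eval x) := by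
  ext i j
  exact aeval_eq_eval_map x _

theorem exists_forall_aeval_eq {n p : ℕ} (F : Fin p → MvPolynomial (Fin n) ℝ)
    (G : MvPolynomial (Fin n) ℝ) {C : Set (Fin n → ℂ)} (hC : @IsIrreducible _ (zariski n) C)
    (hCW : C ⊆ critical F G) {x₀ : Fin n → ℂ} (hx₀ : x₀ ∈ C) (hreg : IsRegularAt F x₀) :
    ∃ c : ℂ, ∀ x ∈ C, aeval x G = c := by
  have := isPrime_vanishingIdeal hC
  let K := (vanishingIdeal ℂ C).ResidueField
  have : Algebra.EssFiniteType ℂ K := essFiniteType_residueField _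
  let toC : MvPolynomial (Fin n) ℝ →+* MvPolynomial (Fin n) ℂ := MvPolynomial.map (algebraMap ℝ ℂ)
  let φ : MvPolynomial (Fin n) ℝ →+* K := (algebraMap (MvPolynomial (Fin n) ℂ) K).comp toC
  have hF (i) : φ (F i) = 0 := by
    refine Ideal.algebraMap_residueField_eq_zero.2 (mem_vanishingIdeal_iff.2 fun x hx => ?_)
    rw [aeval_eq_eval]
    exact (aeval_eq_eval_map x (F i)).symm.trans ((hCW hx).1 i)
  have hJ : LinearIndependent K ((jacobian F).map φ).row := by
    rw [linearIndependent_iff_card_eq_finrank_span, Set.finrank, ← Matrix.rank_eq_finrank_span_row]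
    refine ((rank_residueField_eq_card_iff ((jacobian F).map toC)).2 ⟨x₀, hx₀, ?_⟩).symm
    rwa [IsRegularAt, valueAt_jacobian] at hreg
  have hG : (fun j => φ (pderiv j G)) ∈ Submodule.span K (Set.range ((jacobian F).map φ).row) := by
    -- Otherwise the augmented matrix has rank `p + 1` over `K`, hence at some point of `C`.
    by_contra hG
    have h := (linearIndependent_finSnoc.2 ⟨hJ, hG⟩)
    have hrow : (Fin.snoc ((jacobian F).map φ).row (fun j => φ (pderiv j G)) :
        Fin (p + 1) → Fin n → K) = ((augmented F G).map φ).row := by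
      ext i j
      refine Fin.lastCases ?_ (fun i => ?_) i
      · rw [Fin.snoc_last]
        simp [augmented, jacobian]
      · rw [Fin.snoc_castSucc]
        simp [augmented, jacobian]
    rw [hrow] at h
    obtain ⟨x, hx, hr⟩ := (rank_residueField_eq_card_iff ((augmented F G).map toC)).1 h.rank_matrix
    have hr' := (hCW hx).2
    rw [augmented, valueAt_jacobian] at hr'
    rw [augmented] at hr
    simp only [Fintype.card_fin] at hr
    exact absurd (hr.symm.trans_le hr') (by simp)
  -- `L` sends the gradient of a polynomial to its differential.
  let L : (Fin n → K) →ₗ[K] Ω[K⁄ℂ] := Fintype.linearCombination K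
    fun j => KaehlerDifferential.D ℂ K (algebraMap (MvPolynomial (Fin n) ℂ) K (X j))
  have hL (P : MvPolynomial (Fin n) ℝ) :
      L (fun j => φ (pderiv j P)) = KaehlerDifferential.D ℂ K (φ P) := by
    change _ = KaehlerDifferential.D ℂ K (algebraMap _ K (toC P))
    rw [KaehlerDifferential.D_algebraMap_mvPolynomial]
    simp [L, φ, toC, Fintype.linearCombination_apply, pderiv_map]
  have hDG : KaehlerDifferential.D ℂ K (φ G) = 0 := by
    rw [← hL]
    refine (Submodule.span_le (p := LinearMap.ker L)).2 ?_ hG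
    rintro _ ⟨i, rfl⟩
    refine (hL (F i)).trans ?_
    rw [hF, map_zero]
  have halg : IsAlgebraic ℂ (φ G) := by
    by_contra h
    exact Transcendental.kaehlerDifferential_D_ne_zero h hDG
  -- `ℂ` is algebraically closed, so the minimal polynomial is linear.
  obtain ⟨c, hc⟩ := minpoly.mem_range_of_degree_eq_one ℂ (φ G)
    (IsAlgClosed.degree_eq_one_of_irreducible ℂ (minpoly.irreducible halg.isIntegral))
  refine ⟨c, fun x hx => ?_⟩
  have hmem : toC G - MvPolynomial.C c ∈ vanishingIdeal ℂ C := by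
    rw [← Ideal.algebraMap_residueField_eq_zero, map_sub, sub_eq_zero]
    exact hc.symm.trans (IsScalarTower.algebraMap_apply ℂ (MvPolynomial (Fin n) ℂ) K c)
  have h := mem_vanishingIdeal_iff.1 hmem x hx
  rw [map_sub, sub_eq_zero, aeval_C, aeval_eq_eval] at h
  exact (aeval_eq_eval_map x G).trans h

end PolyOpt

theorem lemma2 (n p : ℕ) (hp : 1 ≤ p) (hpn : p ≤ n)
    (F : Fin p → MvPolynomial (Fin n) ℝ) (G : MvPolynomial (Fin n) ℝ)
    (hne : (PolyOpt.realTrace (PolyOpt.variety F)).Nonempty)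
    (hreg : ∀ x ∈ PolyOpt.realTrace (PolyOpt.variety F), PolyOpt.IsRegularAt F x)
    (hB : PolyOpt.ConditionB F G)
    (C : Set (Fin n → ℂ)) (hC : PolyOpt.IsIrredComponent (PolyOpt.critical F G) C) :
    ∃ b : ℝ, ∀ x ∈ C, MvPolynomial.aeval x G = (b : ℂ) := by
  obtain ⟨x₀, hx₀, hreal⟩ := hB.real_critical C hC
  obtain ⟨c, hc⟩ := PolyOpt.exists_forall_aeval_eq F G hC.1.2 hC.1.1 hx₀
    (hreg x₀ ⟨(hC.1.1 hx₀).1, hreal⟩)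
  have hx : x₀ = fun i => algebraMap ℝ ℂ (x₀ i).re :=
    funext fun i => Complex.ext (by simp) (by simpa using hreal i)
  refine ⟨MvPolynomial.aeval (fun i => (x₀ i).re) G, fun x hxC => ?_⟩
  rw [hc x hxC, ← hc x₀ hx₀, hx]
  exact MvPolynomial.aeval_algebraMap_apply _ _ _
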